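/- Graphs are finite, undirected and without self-loops; $A_G\in\{0,1\}^{n\times n}$ denotes the adjacency matrix of a graph $G$ of order $n$. Expressions of $\mathsf{ML}(\cdot,\mathsf{tr},{}^*,\mathbb{1},\mathsf{diag},\odot)$ are built from one matrix variable $X$, which ranges over square complex matrices, by matrix multiplication $e_1\cdot e_2$, trace $\mathsf{tr}(e)$, conjugate transposition $e^*$, the one-vector $\mathbb{1}(e)$ (the all-ones column vector with as many entries as $e$ has rows), diagonalization $\mathsf{diag}(e)$ of a column vector, and the entrywise (Schur–Hadamard) product $e_1\odot e_2$. Only expressions that are well-formed with respect to the dimensions are considered, where $X$ has dimension $n\times n$ with $n$ symbolic. A sentence is an expression $e(X)$ that returns a $1\times 1$ matrix for every square input matrix. Graphs $G$ and $H$ of the same order are $\mathsf{ML}(\cdot,\mathsf{tr},{}^*,\mathbb{1},\mathsf{diag},\odot)$-equivalent if $e(A_G)=e(A_H)$ for all sentences $e(X)$ of this language. The $2$-dimensional Weisfeiler–Lehman algorithm on $G=(V,E)$ starts with the colour set $C=\{0,1,2\}$ and the colouring $\chi:V\times V\to C$ with $\chi(v,v)=2$, $\chi(v,w)=1$ if $\{v,w\}\in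 E$, and $\chi(v,w)=0$ if $v\ne w$ and $\{v,w\}\notin E$. In each iteration it computes, for all $v_1,v_2\in V$, the structure list $$\mathsf{L}^2(v_1,v_2)=\{(c,d,p)\mid c,d\in C,\ p=|\{v_3\in V\mid \chi(v_1,v_3)=c,\ \chi(v_3,v_2)=d\}|\neq 0\},$$ makes $\mathsf{L}^2(v_1,v_2)$ the new colour of $(v_1,v_2)$, and replaces $C$ by the set of the new colours that occur. It stops after the first iteration in which $|C|$ does not change. (Colours that arise after different numbers of iterations count as different.) The final colouring is the stable colouring, and it induces the stable edge partition of $V\times V$. Graphs $G$ and $H$ of the same order are indistinguishable by the $2$-dimensional Weisfeiler–Lehman algorithm if the parts of their stable edge partitions correspond to the same colours, and for each of these colours the corresponding parts of the two partitions have the same size. Proposition. Let $G$ and $H$ be graphs of the same order. If $G$ and $H$ are $\mathsf{ML}(\cdot,\mathsf{tr},{}^*,\mathbb{1},\mathsf{diag},\odot)$-equivalent, then they are indistinguishable by the $2$-dimensional Weisfeiler–Lehman algorithm. -/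

import Mathlib

universe u

namespace MatLang

/-! ### The matrix query language with operations `·, tr, *, 𝟙, diag, ⊙` -/

/-- Symbolic dimensions: `one` stands for the number `1`, `ord` for the order `n` of the square
matrix that is assigned to the variable `X`. -/
inductive Dim : Type
  | one : Dim
  | ord : Dim

/-- Index set of rows or columns of a symbolic dimension, if the rows and columns of the input
matrix are indexed by `V`. -/
def Dim.Idx (V : Type u) : Dim → Type u
  | .one => PUnit
  | .ord => V

instance Dim.instFintypeIdx (V : Type u) [Fintype V] : (d : Dim) → Fintype (d.Idx V)
  | .one => inferInstanceAs (Fintype PUnit)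
  | .ord => inferInstanceAs (Fintype V)

instance Dim.instDecidableEqIdx (V : Type u) [DecidableEq V] : (d : Dim) → DecidableEq (d.Idx V)
  | .one => inferInstanceAs (DecidableEq PUnit)
  | .ord => inferInstanceAs (DecidableEq V)

/-- Well-formed expressions `e(X)` in the fragment with the operations
`·, tr, *, 𝟙, diag, ⊙`; `Expr a b` consists of the expressions that return an `a × b` matrix.
The single matrix variable `X` ranges over square matrices. -/
inductive Expr : Dim → Dim → Type
  /-- the matrix variable `X` -/
  | var : Expr .ord .ord
  /-- matrix multiplication `e₁ · e₂` -/
  | mul {a b c : Dim} (e₁ : Expr a b) (e₂ : Expr b c) : Expr a c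
  /-- trace `tr(e)` -/
  | tr {a : Dim} (e : Expr a a) : Expr .one .one
  /-- conjugate transposition `e*` -/
  | star {a b : Dim} (e : Expr a b) : Expr b a
  /-- one-vector `𝟙(e)`, with as many entries as `e` has rows -/
  | ones {a b : Dim} (e : Expr a b) : Expr a .one
  /-- diagonalization `diag(e)` of a column vector -/
  | diag {a : Dim} (e : Expr a .one) : Expr a a
  /-- pointwise (Schur-Hadamard) product `e₁ ⊙ e₂` -/
  | had {a b : Dim} (e₁ e₂ : Expr a b) : Expr a b

/-- The value `e(A)` of an expression `e(X)` on a square complex matrix `A`. -/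
def Expr.eval {V : Type u} [Fintype V] [DecidableEq V] (A : Matrix V V ℂ) :
    {a b : Dim} → Expr a b → Matrix (a.Idx V) (b.Idx V) ℂ
  | _, _, .var => A
  | _, _, .mul e₁ e₂ => e₁.eval A * e₂.eval A
  | _, _, .tr e => Matrix.of fun _ _ => (e.eval A).trace
  | _, _, .star e => (e.eval A).conjTranspose
  | _, _, .ones _ => Matrix.of fun _ _ => 1
  | _, _, .diag e => Matrix.diagonal fun i => e.eval A i PUnit.unit
  | _, _, .had e₁ e₂ => Matrix.hadamard (e₁.eval A) (e₂.eval A)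

/-- Sentences are the expressions that return a `1 × 1` matrix, whatever the order of the input. -/
abbrev Sentence : Type := Expr .one .one

/-- The scalar that a sentence returns on `A`. -/
def Sentence.value {V : Type u} [Fintype V] [DecidableEq V] (e : Sentence) (A : Matrix V V ℂ) : ℂ :=
  Expr.eval A e PUnit.unit PUnit.unit

/-- Two graphs are equivalent for the fragment if all its sentences take the same value on their
adjacency matrices. -/
def GraphEquiv {V W : Type*} [Fintype V] [DecidableEq V] [Fintype W] [DecidableEq W]
    (G : SimpleGraph V) [DecidableRel G.Adj] (H : SimpleGraph W) [DecidableRel H.Adj] : Prop :=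
  ∀ e : Sentence, e.value (G.adjMatrix ℂ) = e.value (H.adjMatrix ℂ)

end MatLang

namespace TwoWL

/-! ### The 2-dimensional Weisfeiler-Lehman algorithm -/

/-- Colours available after `i` iterations. The new colour of a pair is its structure list, a set
of triples `(c, d, p)` of two old colours and a number. Hence the runs on different graphs name
their colours consistently. -/
def Colour : ℕ → Type
  | 0 => Fin 3
  | i + 1 => Set (Colour i × Colour i × ℕ)

variable {V : Type u}

open Classical in
/-- The initial colouring: `2` for loops, `1` for edges and `0` for the remaining pairs. -/
noncomputable def initial (G : SimpleGraph V) (v w : V) : Fin 3 :=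
  if v = w then 2 else if G.Adj v w then 1 else 0

/-- The structure constant
`p_{v₁,v₂}^{c,d} = |{v₃ | χ(v₁,v₃) = c, χ(v₃,v₂) = d}|` relative to a colouring `χ`. -/
noncomputable def structureConst {C : Type} (χ : V → V → C) (v₁ v₂ : V) (c d : C) : ℕ :=
  {v₃ : V | χ v₁ v₃ = c ∧ χ v₃ v₂ = d}.ncard

/-- The structure list `{(c, d, p_{v₁,v₂}^{c,d}) | p_{v₁,v₂}^{c,d} ≠ 0}`. -/
def structureList {C : Type} (χ : V → V → C) (v₁ v₂ : V) : Set (C × C × ℕ) :=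
  {t | t.2.2 = structureConst χ v₁ v₂ t.1 t.2.1 ∧ structureConst χ v₁ v₂ t.1 t.2.1 ≠ 0}

/-- The colouring `χ` after `i` iterations. -/
noncomputable def colouring (G : SimpleGraph V) : (i : ℕ) → V → V → Colour i
  | 0 => initial G
  | i + 1 => structureList (colouring G i)

/-- The set of colours `C` after `i` iterations: `{0, 1, 2}` at the beginning, and then a minimal
set, in which every colour is used. -/
def colours (G : SimpleGraph V) : (i : ℕ) → Set (Colour i)
  | 0 => Set.univ
  | i + 1 => Set.range fun p : V × V => colouring G (i + 1) p.1 p.2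

lemma colouring_refines_of_diag (G : SimpleGraph V) [Finite V] (i : ℕ)
    (hd : ∀ a v w : V, colouring G i v w = colouring G i a a → v = w) (v w v' w' : V)
    (h : colouring G (i + 1) v w = colouring G (i + 1) v' w') :
    colouring G i v w = colouring G i v' w' := by
  change structureList (colouring G i) v w = structureList (colouring G i) v' w' at h
  have h1 : ((colouring G i v v, colouring G i v w,
      structureConst (colouring G i) v w (colouring G i v v) (colouring G i v w)) :
      Colour i × Colour i × ℕ) ∈ structureList (colouring G i) v w := by
    refine ⟨rfl, ?_⟩
    refine ((Set.ncard_pos (Set.toFinite _)).2 ⟨v, ?_⟩).ne'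
    exact ⟨rfl, rfl⟩
  rw [h] at h1
  obtain ⟨x, hx1, hx2⟩ := (Set.ncard_pos (Set.toFinite _)).1 (Nat.pos_of_ne_zero h1.2)
  have hx : v' = x := hd _ _ _ hx1
  subst hx
  exact hx2.symm

lemma colouring_diag (G : SimpleGraph V) [Finite V] (i : ℕ) :
    ∀ a v w : V, colouring G i v w = colouring G i a a → v = w := by
  induction i with
  | zero =>
    intro a v w h
    change initial G v w = initial G a a at h
    by_contra hne
    unfold initial at h
    rw [if_neg hne, if_pos rfl] at h
    split_ifs at h <;> exact absurd h (by decide)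
  | succ i ih =>
    intro a v w h
    exact ih a v w (colouring_refines_of_diag G i ih _ _ _ _ h)

/-- The number of colours eventually remains the same in one iteration, so the algorithm stops. -/
lemma exists_stop (G : SimpleGraph V) [Finite V] :
    ∃ r : ℕ, (colours G (r + 1)).ncard = (colours G r).ncard := by
  by_contra! hne
  have hmono : ∀ i, (colours G (i + 1)).ncard ≤ (colours G (i + 2)).ncard := by
    intro i
    let f : V × V → Colour (i + 1) := fun p => colouring G (i + 1) p.1 p.2
    let g : V × V → Colour (i + 2) := fun p => colouring G (i + 2) p.1 p.2
    change (Set.range f).ncard ≤ (Set.range g).ncard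
    rcases isEmpty_or_nonempty (V × V) with hV | ⟨⟨p⟩⟩
    · simp [Set.range_eq_empty]
    have hfac : Function.FactorsThrough f g := fun a b hab =>
      colouring_refines_of_diag G (i + 1) (colouring_diag G (i + 1)) _ _ _ _ hab
    have hr : Set.range f = Function.extend g f (fun _ => f p) '' Set.range g := by
      rw [← Set.range_comp]
      congr 1
      funext q
      exact (hfac.extend_apply _ q).symm
    rw [hr]
    exact Set.ncard_image_le (Set.toFinite _)
  have hgrow : ∀ i, i ≤ (colours G (i + 1)).ncard := by
    intro i
    induction i with
    | zero => exact Nat.zero_le _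
    | succ i ih =>
      have h1 := hmono i
      have h2 := hne (i + 1)
      have h3 : (colours G (i + 1 + 1)).ncard = (colours G (i + 2)).ncard := rfl
      omega
  have hbound : ∀ i, (colours G (i + 1)).ncard ≤ Nat.card (V × V) := by
    intro i
    change (Set.range fun p : V × V => colouring G (i + 1) p.1 p.2).ncard ≤ _
    rw [← Set.image_univ, ← Set.ncard_univ]
    exact Set.ncard_image_le (Set.toFinite _)
  have h1 := hgrow (Nat.card (V × V) + 1)
  have h2 := hbound (Nat.card (V × V) + 1)
  omega

open Classical in
/-- The number of iterations that the algorithm makes: it stops after the first iteration that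
leaves the number of colours `|C|` unchanged. -/
noncomputable def iterations (G : SimpleGraph V) [Finite V] : ℕ :=
  Nat.find (exists_stop G) + 1

/-- The stable colouring, returned by the algorithm. Colours that arise after different numbers of
iterations count as different. -/
noncomputable def stableColouring (G : SimpleGraph V) [Finite V] (v w : V) : Σ i : ℕ, Colour i :=
  ⟨iterations G, colouring G (iterations G) v w⟩

/-- The colours of the parts of the stable edge partition. -/
def stableColours (G : SimpleGraph V) [Finite V] : Set (Σ i : ℕ, Colour i) :=
  Set.range fun p : V × V => stableColouring G p.1 p.2

/-- The part of colour `c` of the stable edge partition. -/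
def stablePart (G : SimpleGraph V) [Finite V] (c : Σ i : ℕ, Colour i) : Set (V × V) :=
  {p | stableColouring G p.1 p.2 = c}

/-- Indistinguishability by the algorithm: the parts of the two stable edge partitions correspond
to the same colours, and parts of the same colour have the same size. -/
def Indistinguishable {V W : Type*} [Finite V] [Finite W] (G : SimpleGraph V) (H : SimpleGraph W) :
    Prop :=
  stableColours G = stableColours H ∧
    ∀ c ∈ stableColours G, (stablePart G c).ncard = (stablePart H c).ncard

end TwoWL

/-! Evaluate each expression on both adjacency matrices at once, as one function on the disjoint
union of `V × V` and `W × W`. The span of these functions is closed under `⊙` and under the matrix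
product. Closure under `⊙` makes it an algebra of functions on a finite set, so it contains the
indicator of every set it cannot split (`Subalgebra.indicator_mem_of_saturated`). By induction on
the iteration, colour classes are such sets: structure constants are entries of products of colour
indicators, so they too lie in the span (`jointColouring_eq_of_not_separated`). Sentences only sum
entries, but linearity carries equality of these sums to the whole span. For an indicator, the sum
is the size of a colour class. Hence all class sizes agree after every iteration, and both runs stop
together. -/

/-! ### Indicators in function algebras on a finite set -/

section FiniteStoneWeierstrass

variable {Z K : Type*} [Fintype Z] [Field K]

/-- A subalgebra of functions on a finite set contains the indicator function of each set that is
saturated for the relation of not being separated by the subalgebra. -/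
lemma Subalgebra.indicator_mem_of_saturated (R : Subalgebra K (Z → K)) (S : Set Z)
    (hS : ∀ z z', (∀ f ∈ R, f z = f z') → z ∈ S → z' ∈ S) :
    S.indicator (1 : Z → K) ∈ R := by
  classical
  have hsep : ∀ z z' : Z, ∃ f ∈ R, f z = 1 ∧ (z ∈ S → z' ∉ S → f z' = 0) := by
    intro z z'
    by_cases h : ∀ f ∈ R, f z = f z'
    · exact ⟨1, R.one_mem, rfl, fun hz hz' => absurd (hS z z' h hz) hz'⟩
    · push Not at h
      obtain ⟨f, hf, hne⟩ := h
      have hne' : f z - f z' ≠ 0 := sub_ne_zero.2 hne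
      -- Affine rescaling of `f` to the value 1 at `z` and 0 at `z'`.
      refine ⟨(f z - f z')⁻¹ • (f - f z' • 1),
        R.smul_mem (R.sub_mem hf (R.smul_mem R.one_mem _)) _, ?_, fun _ _ => ?_⟩
      · simp [hne']
      · simp
  choose f hf hf1 hf0 using hsep
  have hbump : ∀ z, ∏ z', f z z' ∈ R := fun z => R.prod_mem fun z' _ => hf z z'
  -- For `z ∈ S` the bump at `z` is 1 at `z` and 0 off `S`; its other values on `S` are irrelevant.
  -- At `x ∈ S` the factor of `x` vanishes; off `S` every factor is 1.
  suffices h : S.indicator (1 : Z → K) =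
      1 - ∏ z ∈ Finset.univ.filter (· ∈ S), (1 - ∏ z', f z z') by
    rw [h]
    exact R.sub_mem R.one_mem (R.prod_mem fun z _ => R.sub_mem R.one_mem (hbump z))
  funext x
  by_cases hx : x ∈ S
  · have h0 : ∏ z ∈ Finset.univ.filter (· ∈ S), (1 - ∏ z', f z z' x) = 0 := by
      refine Finset.prod_eq_zero (i := x) (by simpa using hx) ?_
      rw [Finset.prod_eq_one fun z' _ => hf1 x z', sub_self]
    simp [hx, Finset.prod_apply, h0]
  · have h1 : ∏ z ∈ Finset.univ.filter (· ∈ S), (1 - ∏ z', f z z' x) = 1 := by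
      refine Finset.prod_eq_one fun z hz => ?_
      have h0 : ∏ z', f z z' x = 0 :=
        Finset.prod_eq_zero (Finset.mem_univ x) (hf0 z x (by simpa using hz) hx)
      rw [h0, sub_zero]
    simp [hx, Finset.prod_apply, h1]

end FiniteStoneWeierstrass

/-! ### The algebra of joint values of expressions -/

namespace MatLang

section JointValues

variable {V W : Type*} [Fintype V] [DecidableEq V] [Fintype W] [DecidableEq W]

/-- The entries of the values of an expression on two matrices, as one function. -/
def jointEval (A : Matrix V V ℂ) (B : Matrix W W ℂ) (e : Expr .ord .ord) :
    (V × V) ⊕ (W × W) → ℂ :=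
  Sum.elim (fun p => e.eval A p.1 p.2) (fun p => e.eval B p.1 p.2)

/-- The matrix product, taken in both components of a pair of matrices. -/
def jointMul (f g : (V × V) ⊕ (W × W) → ℂ) : (V × V) ⊕ (W × W) → ℂ :=
  Sum.elim (fun p => ∑ x, f (.inl (p.1, x)) * g (.inl (x, p.2)))
    (fun p => ∑ x, f (.inr (p.1, x)) * g (.inr (x, p.2)))

/-- The all-ones matrix as an expression. -/
def Expr.allOnes : Expr .ord .ord := .mul (.ones .var) (.star (.ones .var))

/-- The identity matrix as an expression. -/
def Expr.identity : Expr .ord .ord := .diag (.ones .var)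

/-- The sum of all entries as a sentence. -/
def Expr.entrySum (e : Expr .ord .ord) : Sentence :=
  .mul (.star (.ones .var)) (.mul e (.ones .var))

lemma Expr.eval_allOnes (A : Matrix V V ℂ) (v w : V) : Expr.allOnes.eval A v w = 1 := by
  change ∑ _x : PUnit, (1 : ℂ) * (starRingEnd ℂ) 1 = 1
  simp

lemma Expr.eval_identity (A : Matrix V V ℂ) (v w : V) :
    Expr.identity.eval A v w = if v = w then 1 else 0 :=
  Matrix.diagonal_apply (d := fun _ : V => (1 : ℂ)) v w

lemma Expr.value_entrySum (A : Matrix V V ℂ) (e : Expr .ord .ord) :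
    e.entrySum.value A = ∑ p : V × V, e.eval A p.1 p.2 := by
  change ∑ v : V, (starRingEnd ℂ) 1 * ∑ w : V, e.eval A v w * 1 = _
  simp [Fintype.sum_prod_type]

lemma jointEval_mul (A : Matrix V V ℂ) (B : Matrix W W ℂ) (e₁ e₂ : Expr .ord .ord) :
    jointEval A B (.mul e₁ e₂) = jointMul (jointEval A B e₁) (jointEval A B e₂) := by
  funext z
  rcases z with p | p <;> rfl

lemma jointEval_had (A : Matrix V V ℂ) (B : Matrix W W ℂ) (e₁ e₂ : Expr .ord .ord) :
    jointEval A B (.had e₁ e₂) = jointEval A B e₁ * jointEval A B e₂ := by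
  funext z
  rcases z with p | p <;> rfl

lemma jointEval_allOnes (A : Matrix V V ℂ) (B : Matrix W W ℂ) :
    jointEval A B Expr.allOnes = 1 := by
  funext z
  rcases z with p | p <;> exact Expr.eval_allOnes _ _ _

/-- The linear combinations of the joint values of expressions, a subalgebra for the entrywise
product. -/
def jointSpan (A : Matrix V V ℂ) (B : Matrix W W ℂ) :
    Subalgebra ℂ ((V × V) ⊕ (W × W) → ℂ) :=
  (Submodule.span ℂ (Set.range (jointEval A B))).toSubalgebra
    (Submodule.subset_span ⟨_, jointEval_allOnes A B⟩) (by
      intro f g hf hg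
      induction hf, hg using Submodule.span_induction₂ with
      | mem_mem f g hf hg =>
        obtain ⟨e₁, rfl⟩ := hf
        obtain ⟨e₂, rfl⟩ := hg
        exact Submodule.subset_span ⟨_, jointEval_had A B e₁ e₂⟩
      | zero_left => simp
      | zero_right => simp
      | add_left f₁ f₂ g _ _ _ h₁ h₂ => rw [add_mul]; exact add_mem h₁ h₂
      | add_right f g₁ g₂ _ _ _ h₁ h₂ => rw [mul_add]; exact add_mem h₁ h₂
      | smul_left r f g _ _ h => rw [smul_mul_assoc]; exact Submodule.smul_mem _ r h
      | smul_right r f g _ _ h => rw [mul_smul_comm]; exact Submodule.smul_mem _ r h)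

lemma jointEval_mem_jointSpan (A : Matrix V V ℂ) (B : Matrix W W ℂ) (e : Expr .ord .ord) :
    jointEval A B e ∈ jointSpan A B :=
  Submodule.subset_span (Set.mem_range_self e)

/-- The matrix product on pairs of matrices as a bilinear map. -/
def jointMulBilin : ((V × V) ⊕ (W × W) → ℂ) →ₗ[ℂ] ((V × V) ⊕ (W × W) → ℂ) →ₗ[ℂ]
    ((V × V) ⊕ (W × W) → ℂ) :=
  LinearMap.mk₂ ℂ jointMul
    (fun f f' g => by
      funext z; rcases z with p | p <;> simp [jointMul, add_mul, Finset.sum_add_distrib])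
    (fun r f g => by
      funext z; rcases z with p | p <;> simp [jointMul, mul_assoc, Finset.mul_sum])
    (fun f g g' => by
      funext z; rcases z with p | p <;> simp [jointMul, mul_add, Finset.sum_add_distrib])
    (fun r f g => by
      funext z; rcases z with p | p <;> simp [jointMul, mul_left_comm, Finset.mul_sum])

/-- Bilinearity reduces this to generators, where the product is the joint value of `e₁ · e₂`. -/
lemma jointMul_mem_jointSpan {A : Matrix V V ℂ} {B : Matrix W W ℂ}
    {f g : (V × V) ⊕ (W × W) → ℂ} (hf : f ∈ jointSpan A B) (hg : g ∈ jointSpan A B) :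
    jointMul f g ∈ jointSpan A B := by
  have h := Submodule.apply_mem_map₂ jointMulBilin ((Subalgebra.mem_toSubmodule _).2 hf)
    ((Subalgebra.mem_toSubmodule _).2 hg)
  change _ ∈ Submodule.map₂ _ (Submodule.span ℂ _) (Submodule.span ℂ _) at h
  rw [Submodule.map₂_span_span] at h
  refine Submodule.span_mono ?_ h
  rintro _ ⟨_, ⟨e₁, rfl⟩, _, ⟨e₂, rfl⟩, rfl⟩
  exact ⟨_, jointEval_mul A B e₁ e₂⟩

/-- If no sentence separates two matrices, then the two components of each member of `jointSpan`
have the same sum of entries. -/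
lemma sum_inl_eq_sum_inr_of_mem_jointSpan {A : Matrix V V ℂ} {B : Matrix W W ℂ}
    (hAB : ∀ e : Sentence, e.value A = e.value B)
    {f : (V × V) ⊕ (W × W) → ℂ} (hf : f ∈ jointSpan A B) :
    ∑ p, f (.inl p) = ∑ p, f (.inr p) := by
  change f ∈ Submodule.span ℂ _ at hf
  induction hf using Submodule.span_induction with
  | mem f hf =>
    obtain ⟨e, rfl⟩ := hf
    have h := hAB e.entrySum
    rwa [Expr.value_entrySum, Expr.value_entrySum] at h
  | zero => simp
  | add f g _ _ hf hg => simp [Finset.sum_add_distrib, hf, hg]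
  | smul r f _ hf => simp [← Finset.mul_sum, hf]

end JointValues

end MatLang

/-! ### Colour classes and equivalence of graphs -/

namespace TwoWL

open MatLang

section Joint

variable {V W : Type*}

/-- The colourings of the pairs of vertices of two graphs after `i` iterations. -/
noncomputable def jointColouring (G : SimpleGraph V) (H : SimpleGraph W) (i : ℕ) :
    (V × V) ⊕ (W × W) → Colour i :=
  Sum.elim (fun p => colouring G i p.1 p.2) (fun p => colouring H i p.1 p.2)

/-- The structure constants of the pairs of vertices of two graphs. -/
noncomputable def jointStructureConst (G : SimpleGraph V) (H : SimpleGraph W) (i : ℕ)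
    (c d : Colour i) : (V × V) ⊕ (W × W) → ℕ :=
  Sum.elim (fun p => structureConst (colouring G i) p.1 p.2 c d)
    (fun p => structureConst (colouring H i) p.1 p.2 c d)

lemma jointColouring_succ (G : SimpleGraph V) (H : SimpleGraph W) (i : ℕ)
    (z : (V × V) ⊕ (W × W)) :
    jointColouring G H (i + 1) z =
      {t | t.2.2 = jointStructureConst G H i t.1 t.2.1 z ∧
        jointStructureConst G H i t.1 t.2.1 z ≠ 0} := by
  rcases z with p | p <;> rfl

variable [Fintype V] [Fintype W]

open Classical in
lemma structureConst_eq_sum {C : Type} (χ : V → V → C) (v₁ v₂ : V) (c d : C) :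
    (structureConst χ v₁ v₂ c d : ℂ) =
      ∑ x, (if χ v₁ x = c then 1 else 0) * (if χ x v₂ = d then 1 else 0) := by
  simp [structureConst, Set.ncard_eq_toFinset_card', ← ite_and, and_comm]

/-- Turns a refinement step into matrix multiplication: a vertex adds 1 to the entry exactly when it
is counted by the structure constant. -/
lemma jointStructureConst_eq_jointMul (G : SimpleGraph V) (H : SimpleGraph W) (i : ℕ)
    (c d : Colour i) (z : (V × V) ⊕ (W × W)) :
    (jointStructureConst G H i c d z : ℂ) =
      jointMul ((jointColouring G H i ⁻¹' {c}).indicator 1)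
        ((jointColouring G H i ⁻¹' {d}).indicator 1) z := by
  classical
  rcases z with p | p <;>
    simp [jointStructureConst, jointMul, structureConst_eq_sum, Set.indicator_apply,
      jointColouring]

variable [DecidableEq V] [DecidableEq W]

/-- Pairs of vertices with different colours are separated by an expression. -/
lemma jointColouring_eq_of_not_separated (G : SimpleGraph V) [DecidableRel G.Adj]
    (H : SimpleGraph W) [DecidableRel H.Adj] (i : ℕ) (z z' : (V × V) ⊕ (W × W))
    (h : ∀ f ∈ jointSpan (G.adjMatrix ℂ) (H.adjMatrix ℂ), f z = f z') :
    jointColouring G H i z = jointColouring G H i z' := by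
  induction i generalizing z z' with
  | zero =>
    -- The initial colour depends only on the entries of the identity and of `X`.
    have key : ∀ z, jointColouring G H 0 z =
        (if jointEval (G.adjMatrix ℂ) (H.adjMatrix ℂ) Expr.identity z = 1 then 2 else
          if jointEval (G.adjMatrix ℂ) (H.adjMatrix ℂ) .var z = 1 then 1 else 0 : Fin 3) := by
      rintro (p | p)
      · change initial G p.1 p.2 = if Expr.identity.eval (G.adjMatrix ℂ) p.1 p.2 = 1 then 2 else
          if G.adjMatrix ℂ p.1 p.2 = 1 then 1 else 0
        simp only [initial, Expr.eval_identity, SimpleGraph.adjMatrix_apply]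
        split_ifs <;> simp_all
      · change initial H p.1 p.2 = if Expr.identity.eval (H.adjMatrix ℂ) p.1 p.2 = 1 then 2 else
          if H.adjMatrix ℂ p.1 p.2 = 1 then 1 else 0
        simp only [initial, Expr.eval_identity, SimpleGraph.adjMatrix_apply]
        split_ifs <;> simp_all
    rw [key, key, h _ (jointEval_mem_jointSpan _ _ _), h _ (jointEval_mem_jointSpan _ _ _)]
  | succ i ih =>
    -- The induction hypothesis says precisely that colour classes are saturated.
    have hind (c : Colour i) : (jointColouring G H i ⁻¹' {c}).indicator 1 ∈
        jointSpan (G.adjMatrix ℂ) (H.adjMatrix ℂ) :=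
      Subalgebra.indicator_mem_of_saturated _ _ fun y y' hy hc => (ih y y' hy).symm.trans hc
    have hconst (c d : Colour i) :
        jointStructureConst G H i c d z = jointStructureConst G H i c d z' := by
      have h' := h _ (jointMul_mem_jointSpan (hind c) (hind d))
      rw [← jointStructureConst_eq_jointMul, ← jointStructureConst_eq_jointMul] at h'
      exact_mod_cast h'
    rw [jointColouring_succ, jointColouring_succ]
    simp only [hconst]
    rfl

/-- After any number of iterations, each colour occurs equally often in equivalent graphs. -/
lemma ncard_colouring_eq_of_graphEquiv {G : SimpleGraph V} [DecidableRel G.Adj]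
    {H : SimpleGraph W} [DecidableRel H.Adj] (hGH : GraphEquiv G H) (i : ℕ) (c : Colour i) :
    {p : V × V | colouring G i p.1 p.2 = c}.ncard =
      {p : W × W | colouring H i p.1 p.2 = c}.ncard := by
  classical
  have hind : (jointColouring G H i ⁻¹' {c}).indicator 1 ∈
      jointSpan (G.adjMatrix ℂ) (H.adjMatrix ℂ) :=
    Subalgebra.indicator_mem_of_saturated _ _ fun y y' hy hc =>
      (jointColouring_eq_of_not_separated G H i y y' hy).symm.trans hc
  have h := sum_inl_eq_sum_inr_of_mem_jointSpan hGH hind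
  simp only [Set.indicator_apply, Set.mem_preimage, Set.mem_singleton_iff, jointColouring,
    Sum.elim_inl, Sum.elim_inr, Pi.one_apply, Finset.sum_boole, Nat.cast_inj] at h
  simpa [Set.ncard_eq_toFinset_card'] using h

lemma range_colouring_eq_of_graphEquiv {G : SimpleGraph V} [DecidableRel G.Adj]
    {H : SimpleGraph W} [DecidableRel H.Adj] (hGH : GraphEquiv G H) (i : ℕ) :
    (Set.range fun p : V × V => colouring G i p.1 p.2) =
      Set.range fun p : W × W => colouring H i p.1 p.2 := by
  ext c
  have h := ncard_colouring_eq_of_graphEquiv hGH i c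
  have h' := (Set.ncard_pos (Set.toFinite {p : V × V | colouring G i p.1 p.2 = c})).symm
  rw [h, Set.ncard_pos (Set.toFinite _)] at h'
  exact h'

/-- The stopping rule sees only the sets `colours`, which agree: by definition at 0, as ranges
afterwards. -/
lemma iterations_eq_of_graphEquiv {G : SimpleGraph V} [DecidableRel G.Adj]
    {H : SimpleGraph W} [DecidableRel H.Adj] (hGH : GraphEquiv G H) :
    iterations G = iterations H := by
  have hcol : colours G = colours H := by
    funext i
    cases i with
    | zero => rfl
    | succ i => exact range_colouring_eq_of_graphEquiv hGH (i + 1)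
  simp only [iterations, hcol]

end Joint

end TwoWL

theorem mainTheorem6 {V W : Type*} [Fintype V] [DecidableEq V] [Fintype W] [DecidableEq W]
    (G : SimpleGraph V) [DecidableRel G.Adj] (H : SimpleGraph W) [DecidableRel H.Adj]
    (hcard : Fintype.card V = Fintype.card W) (hGH : MatLang.GraphEquiv G H) :
    TwoWL.Indistinguishable G H := by
  -- With a common iteration number, equality of stable colours reduces to equality in a single
  -- `Colour i`.
  have hG : TwoWL.stableColouring G = fun v w =>
      ⟨TwoWL.iterations H, TwoWL.colouring G (TwoWL.iterations H) v w⟩ := by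
    unfold TwoWL.stableColouring
    rw [TwoWL.iterations_eq_of_graphEquiv hGH]
  have hrange : TwoWL.stableColours G = TwoWL.stableColours H := by
    have h := congrArg (Set.image (Sigma.mk (TwoWL.iterations H)))
      (TwoWL.range_colouring_eq_of_graphEquiv hGH (TwoWL.iterations H))
    rw [← Set.range_comp, ← Set.range_comp] at h
    rw [TwoWL.stableColours, hG]
    exact h
  refine ⟨hrange, ?_⟩
  rintro _ ⟨q, rfl⟩
  have h := TwoWL.ncard_colouring_eq_of_graphEquiv hGH _
    (TwoWL.colouring G (TwoWL.iterations H) q.1 q.2)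
  simp only [TwoWL.stablePart, hG]
  simpa only [TwoWL.stableColouring, Sigma.mk.injEq, heq_eq_eq, true_and] using h
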